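/- Conventions. A \emph{continuum} is a non-empty compact connected metrizable space; a subcontinuum is a subspace that is a continuum. A continuum $X$ is \emph{unicoherent} if $A\cap B$ is connected whenever $A,B$ are subcontinua with $X=A\cup B$, and \emph{hereditarily unicoherent} if each of its subcontinua is unicoherent. An \emph{arc} is a space homeomorphic to $[0,1]$. A \emph{dendroid} is an arcwise connected, hereditarily unicoherent continuum. A point $x$ of a dendroid $X$ is an \emph{end-point} of $X$ if it is an end-point of every arc in $X$ that contains it, and a \emph{ramification point} of $X$ if there are a subspace $T\subseteq X$ and a homeomorphism $\varphi:([-1,1]\times\{0\})\cup(\{0\}\times[0,1])\to T$ with $\varphi(0,0)=x$. A \emph{fan} is a dendroid with at most one ramification point; this point, if it exists, is called its top. Let $F=\bigcup_{c\in C}S_c\subseteq\mathbb R^2$ be the Cantor fan, where $C\subseteq[0,1]$ is the standard Cantor set and $S_c$ is the straight line segment from $(0,0)$ to $(c,1)$. \textbf{Theorem.} Let $X\subseteq F$ be a fan that has a top, and let $a$ be an end-point of $X$. Let $\sim$ be the equivalence relation on $X$ defined by $$x\sim y\iff x=y\ \text{ or there is } t\in[0,1] \text{ such that } x=t\cdot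 a \text{ and } y=(1-t)\cdot a .$$ Then the quotient space $J=X/_{\sim}$ is a fan (in particular, $J$ is metrizable). -/

import Mathlib

/-- A continuum: a non-empty compact connected metrizable space
(`ConnectedSpace` includes non-emptiness). -/
def IsContinuum (X : Type*) [TopologicalSpace X] : Prop :=
  CompactSpace X ∧ ConnectedSpace X ∧ TopologicalSpace.MetrizableSpace X

/-- A subset that is itself a continuum in the subspace topology. -/
def IsSubcontinuum {X : Type*} [TopologicalSpace X] (A : Set X) : Prop :=
  IsContinuum A

/-- Whenever `X` is the union of two subcontinua, their intersection is connected. -/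
def IsUnicoherent (X : Type*) [TopologicalSpace X] : Prop :=
  ∀ A B : Set X, IsSubcontinuum A → IsSubcontinuum B → A ∪ B = Set.univ → IsConnected (A ∩ B)

/-- Every subcontinuum is unicoherent. -/
def IsHereditarilyUnicoherent (X : Type*) [TopologicalSpace X] : Prop :=
  ∀ K : Set X, IsSubcontinuum K → IsUnicoherent K

/-- `A` is an arc in `X` (a subspace homeomorphic to `[0,1]`). -/
def IsArc {X : Type*} [TopologicalSpace X] (A : Set X) : Prop :=
  Nonempty (unitInterval ≃ₜ A)

/-- `x` is an end-point of the arc `A`. -/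
def IsArcEndPoint {X : Type*} [TopologicalSpace X] (A : Set X) (x : X) : Prop :=
  ∃ φ : unitInterval ≃ₜ A, (φ 0 : X) = x

/-- Any two distinct points are the two end-points of an arc. -/
def IsArcwiseConnected (X : Type*) [TopologicalSpace X] : Prop :=
  ∀ x y : X, x ≠ y → ∃ (A : Set X) (φ : unitInterval ≃ₜ A), (φ 0 : X) = x ∧ (φ 1 : X) = y

/-- A dendroid: an arcwise connected, hereditarily unicoherent continuum. -/
def IsDendroid (X : Type*) [TopologicalSpace X] : Prop :=
  IsContinuum X ∧ IsArcwiseConnected X ∧ IsHereditarilyUnicoherent X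

/-- The set of end-points of a dendroid: points that are an end-point of every arc
containing them. -/
def endPoints (X : Type*) [TopologicalSpace X] : Set X :=
  {x | ∀ A : Set X, IsArc A → x ∈ A → IsArcEndPoint A x}

/-- The model simple triod `([-1,1] × {0}) ∪ ({0} × [0,1])` in the plane. -/
def simpleTriod : Set (ℝ × ℝ) :=
  Set.Icc (-1) 1 ×ˢ {0} ∪ {0} ×ˢ Set.Icc 0 1

theorem zero_mem_simpleTriod : ((0, 0) : ℝ × ℝ) ∈ simpleTriod := by
  simp [simpleTriod]

/-- The set of ramification points of a dendroid: tops of simple triods contained in it. -/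
def ramificationPoints (X : Type*) [TopologicalSpace X] : Set X :=
  {x | ∃ (T : Set X) (φ : simpleTriod ≃ₜ T), (φ ⟨(0, 0), zero_mem_simpleTriod⟩ : X) = x}

/-- A fan: a dendroid with at most one ramification point. -/
def IsFan (X : Type*) [TopologicalSpace X] : Prop :=
  IsDendroid X ∧ (ramificationPoints X).Subsingleton

/-- The Cantor fan: the union of the straight segments in the plane from `(0,0)` to `(c,1)`,
where `c` runs through the standard Cantor set. -/
def cantorFan : Set (ℝ × ℝ) :=
  ⋃ c ∈ cantorSet, segment ℝ ((0, 0) : ℝ × ℝ) (c, 1)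

/-- The equivalence relation on `X` that identifies `t • a` with `(1 - t) • a` for
`t ∈ [0,1]` (and nothing else), i.e. folds the segment from `(0,0)` to `a` at its midpoint. -/
def foldSetoid (X : Set (ℝ × ℝ)) (a : X) : Setoid X where
  r x y := x = y ∨ ∃ t ∈ Set.Icc (0 : ℝ) 1,
    (x : ℝ × ℝ) = t • (a : ℝ × ℝ) ∧ (y : ℝ × ℝ) = (1 - t) • (a : ℝ × ℝ)
  iseqv := by
    refine ⟨fun x => Or.inl rfl, ?_, ?_⟩
    · rintro x y (h | ⟨t, ⟨h0, h1⟩, hx, hy⟩)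
      · exact Or.inl h.symm
      · exact Or.inr ⟨1 - t, ⟨by linarith, by linarith⟩, hy, by simpa using hx⟩
    · rintro x y z (rfl | ⟨t, ht, hx, hy⟩) (rfl | ⟨s, hs, hy', hz⟩)
      · exact Or.inl rfl
      · exact Or.inr ⟨s, hs, hy', hz⟩
      · exact Or.inr ⟨t, ht, hx, hy⟩
      · left
        apply Subtype.ext
        have h : (1 - t) • (a : ℝ × ℝ) = s • (a : ℝ × ℝ) := hy.symm.trans hy'
        rw [hx, hz, sub_smul, ← h, sub_smul]
        simp

/-- The quotient space of `X` by `foldSetoid`, with the quotient topology. -/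
abbrev FoldQuotient (X : Set (ℝ × ℝ)) (a : X) : Type :=
  Quotient (foldSetoid X a)

open Set Topology Filter

/-! Only the origin can ramify in a subspace of the Cantor fan, so a fan with a top contains it.
Connectedness then makes `X` star-shaped about the origin, and the end-point `a` is the nonzero tip
of its ray. Folding replaces that segment by its lower half, so the quotient is again a union of
arcs issuing from the class `o` of the origin. What makes such a union a fan is isolated in
`IsLegSystem`; `IsLegSystem.isFan` deduces the fan property for compact connected metrizable spaces.
The two substantial axioms come from separation by lines whose slope parameter lies outside the
Cantor set: `label_const` confines connected sets missing `o` to one ray, and `not_mem_between`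
shows that closed connected sets through `o` have no gaps along a leg. Metrizability comes from an
explicit map to Euclidean space whose fibres are the classes. -/

theorem exists_notMem_cantorSet {x y : ℝ} (h : x < y) : ∃ α ∈ Ioo x y, α ∉ cantorSet := by
  by_contra! hc
  have hd : IsTotallyDisconnected cantorSet := by
    rw [← totallyDisconnectedSpace_subtype_iff]
    exact cantorSetHomeomorphNatToBool.symm.totallyDisconnectedSpace
  have hs := hd (Ioo x y) hc isPreconnected_Ioo
  have h1 : (2 * x + y) / 3 ∈ Ioo x y := ⟨by linarith, by linarith⟩
  have h2 : (x + 2 * y) / 3 ∈ Ioo x y := ⟨by linarith, by linarith⟩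
  have := hs h1 h2
  linarith

/-! ### Arcs and end-points -/

section Arcs

variable {Y : Type*} [TopologicalSpace Y] [T2Space Y] {γ : unitInterval → Y}

theorem exists_homeomorph_range (hc : Continuous γ) (hi : Function.Injective γ) :
    ∃ φ : unitInterval ≃ₜ range γ, ∀ t, (φ t : Y) = γ t :=
  ⟨(hc.isClosedEmbedding hi).isEmbedding.toHomeomorph, fun _ => rfl⟩

/-- Two parametrisations of an arc differ by a homeomorphism of the interval, which is strictly
monotone or antitone and so cannot send 0 to an interior point. -/
theorem notMem_endPoints (hc : Continuous γ) (hi : Function.Injective γ) {t : unitInterval}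
    (h0 : 0 < t) (h1 : t < 1) : γ t ∉ endPoints Y := by
  intro h
  obtain ⟨φ, hφ⟩ := exists_homeomorph_range hc hi
  obtain ⟨ψ, hψ⟩ := h (range γ) ⟨φ⟩ ⟨t, rfl⟩
  set χ : unitInterval ≃ₜ unitInterval := ψ.trans φ.symm with hχ
  have hχ0 : χ 0 = t := by
    have : ψ 0 = φ t := Subtype.ext (by rw [hψ, hφ])
    simp [hχ, this]
  rcases χ.continuous.strictMono_of_inj χ.injective with hm | hm
  · have := hm.monotone (unitInterval.nonneg' (t := χ.symm 0))
    rw [hχ0, χ.apply_symm_apply] at this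
    exact absurd h0 (not_lt.mpr this)
  · have := hm.antitone (unitInterval.nonneg' (t := χ.symm 1))
    rw [hχ0, χ.apply_symm_apply] at this
    exact absurd h1 (not_lt.mpr this)

end Arcs

/-! ### Excluding triods -/

section Triod

theorem smul_mem_simpleTriod {t : ℝ} (h0 : 0 ≤ t) (h1 : t ≤ 1) (i : Fin 3) :
    t • (![(1, 0), (-1, 0), (0, 1)] : Fin 3 → ℝ × ℝ) i ∈ simpleTriod := by
  fin_cases i <;> simp [simpleTriod] <;> grind

/-- The arms of the simple triod, transported along a homeomorphism. -/
def triodArm {Y : Type*} [TopologicalSpace Y] {T : Set Y} (φ : simpleTriod ≃ₜ T) (i : Fin 3)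
    (t : unitInterval) : Y :=
  φ ⟨(t : ℝ) • (![(1, 0), (-1, 0), (0, 1)] : Fin 3 → ℝ × ℝ) i, smul_mem_simpleTriod t.2.1 t.2.2 i⟩

variable {Y : Type*} [TopologicalSpace Y] {T : Set Y} (φ : simpleTriod ≃ₜ T)

theorem continuous_triodArm (i : Fin 3) : Continuous (triodArm φ i) := by
  unfold triodArm
  fun_prop

theorem triodArm_zero (i : Fin 3) : triodArm φ i 0 = φ ⟨(0, 0), zero_mem_simpleTriod⟩ := by
  simp only [triodArm, Set.Icc.coe_zero, zero_smul]
  rfl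

theorem triodArm_eq {i j : Fin 3} {s t : unitInterval} (hij : i ≠ j)
    (h : triodArm φ i s = triodArm φ j t) : s = 0 ∧ t = 0 := by
  have h' := congrArg Subtype.val (φ.injective (Subtype.ext h))
  have hs := s.2.1
  have ht := t.2.1
  suffices (s : ℝ) = 0 ∧ (t : ℝ) = 0 from ⟨Subtype.ext this.1, Subtype.ext this.2⟩
  clear h
  dsimp only at h'
  generalize (s : ℝ) = s at *
  generalize (t : ℝ) = t at *
  fin_cases i <;> fin_cases j <;> simp_all <;> (try constructor) <;> linarith

/-- A small triod around a point off `O` would inject continuously into the line. Two of its three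
arm tips then have values on the same side of the centre's value, and the intermediate value theorem
breaks injectivity. -/
theorem ramificationPoints_subset {O : Set Y} (hO : IsClosed O)
    (h : ∀ S : Set Y, IsPreconnected S → Disjoint S O →
      ∃ g : Y → ℝ, ContinuousOn g S ∧ InjOn g S) : ramificationPoints Y ⊆ O := by
  rintro x ⟨T, φ, hx⟩
  by_contra hxO
  have hev : ∀ᶠ t in 𝓝 (0 : unitInterval), ∀ i, triodArm φ i t ∉ O := by
    rw [eventually_all]
    intro i
    refine (continuous_triodArm φ i).continuousAt.eventually_mem (hO.isOpen_compl.mem_nhds ?_)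
    rwa [triodArm_zero, hx]
  obtain ⟨ε, hε0, hε⟩ : ∃ ε : unitInterval, 0 < ε ∧ ∀ t ≤ ε, ∀ i, triodArm φ i t ∉ O := by
    obtain ⟨u, hu, hu'⟩ := exists_Ico_subset_of_mem_nhds hev ⟨1, zero_lt_one⟩
    obtain ⟨ε, h0, h1⟩ := exists_between hu
    exact ⟨ε, h0, fun t ht => hu' ⟨unitInterval.nonneg', ht.trans_lt h1⟩⟩
  set S : Set Y := ⋃ i, triodArm φ i '' Icc 0 ε with hS
  have hmem : ∀ i, ∀ t ∈ Icc 0 ε, triodArm φ i t ∈ S := fun i t ht =>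
    mem_iUnion.2 ⟨i, t, ht, rfl⟩
  have h0ε : (0 : unitInterval) ∈ Icc 0 ε := ⟨le_rfl, hε0.le⟩
  have hεε : ε ∈ Icc 0 ε := ⟨hε0.le, le_rfl⟩
  have hSc : IsPreconnected S := by
    refine isPreconnected_iUnion ⟨x, mem_iInter.2 fun i => ⟨0, h0ε, ?_⟩⟩ fun i =>
      isPreconnected_Icc.image _ (continuous_triodArm φ i).continuousOn
    rw [triodArm_zero, hx]
  have hSO : Disjoint S O := by
    rw [Set.disjoint_left]
    intro y hy
    obtain ⟨i, t, ht, rfl⟩ := mem_iUnion.1 hy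
    exact hε t ht.2 i
  have key : ∀ g : Y → ℝ, ContinuousOn g S → InjOn g S → ∀ i j, i ≠ j →
      g x < g (triodArm φ i ε) → g (triodArm φ i ε) ≤ g (triodArm φ j ε) → False := by
    intro g hg hgi i j hij h1 h2
    have hcont : ContinuousOn (g ∘ triodArm φ j) (Icc 0 ε) :=
      hg.comp (continuous_triodArm φ j).continuousOn fun t ht => hmem j t ht
    have hx0 : triodArm φ j 0 = x := by rw [triodArm_zero, hx]
    obtain ⟨t, ht, hte⟩ := intermediate_value_Icc hε0.le hcont
      (show g (triodArm φ i ε) ∈ _ from ⟨by simpa [hx0] using h1.le, h2⟩)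
    have := hgi (hmem j t ht) (hmem i ε hεε) hte
    exact hε0.ne' (triodArm_eq φ hij.symm this).2
  have key2 : ∀ g : Y → ℝ, ContinuousOn g S → InjOn g S → ∀ i j, i ≠ j →
      g x < g (triodArm φ i ε) → g x < g (triodArm φ j ε) → False := by
    intro g hg hgi i j hij h1 h2
    rcases le_total (g (triodArm φ i ε)) (g (triodArm φ j ε)) with h3 | h3
    · exact key g hg hgi i j hij h1 h3
    · exact key g hg hgi j i hij.symm h2 h3
  obtain ⟨g, hg, hgi⟩ := h S hSc hSO
  have hne : ∀ i, g x ≠ g (triodArm φ i ε) := by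
    intro i hgx
    obtain ⟨j, hj⟩ : ∃ j, i ≠ j := ⟨i + 1, by fin_cases i <;> decide⟩
    have hx0 : triodArm φ j 0 = x := by rw [triodArm_zero, hx]
    rw [← hx0] at hgx
    exact hε0.ne' (triodArm_eq φ hj.symm (hgi (hmem j 0 h0ε) (hmem i ε hεε) hgx)).2
  -- Negating `g` rules out two tips below the centre; three tips cannot avoid both cases.
  have hneg := key2 (fun y => -g y) hg.neg fun y hy z hz hyz => hgi hy hz (neg_injective hyz)
  have hpos := key2 g hg hgi
  simp only [neg_lt_neg_iff] at hneg
  rcases (hne 0).lt_or_gt with h0 | h0 <;> rcases (hne 1).lt_or_gt with h1 | h1 <;>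
    rcases (hne 2).lt_or_gt with h2 | h2
  all_goals first
    | exact hpos 0 1 (by decide) h0 h1
    | exact hpos 0 2 (by decide) h0 h2
    | exact hpos 1 2 (by decide) h1 h2
    | exact hneg 0 1 (by decide) h0 h1
    | exact hneg 0 2 (by decide) h0 h2
    | exact hneg 1 2 (by decide) h1 h2

end Triod

/-! ### Leg systems and why they are fans -/

/-- `Y` is a union of arcs `e i` ("legs") issuing from the common point `o`, such that a connected
set missing `o` lies in one leg, and a closed connected set containing `o` meets each leg in an
initial part. -/
structure IsLegSystem {Y ι : Type*} [TopologicalSpace Y] (o : Y) (e : ι → unitInterval → Y) :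
    Prop where
  continuous : ∀ i, Continuous (e i)
  injective : ∀ i, Function.Injective (e i)
  apply_zero : ∀ i, e i 0 = o
  nonempty : Nonempty ι
  exists_leg : ∀ S : Set Y, IsPreconnected S → S.Nonempty → o ∉ S → ∃ i, S ⊆ range (e i)
  downward : ∀ B : Set Y, IsClosed B → IsPreconnected B → o ∈ B →
    ∀ i s t, s ≤ t → e i t ∈ B → e i s ∈ B

theorem exists_arc {Y : Type*} [TopologicalSpace Y] [T2Space Y] {γ : unitInterval → Y}
    (hc : Continuous γ) (hi : Function.Injective γ) :
    ∃ (A : Set Y) (φ : unitInterval ≃ₜ A), (φ 0 : Y) = γ 0 ∧ (φ 1 : Y) = γ 1 := by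
  obtain ⟨φ, hφ⟩ := exists_homeomorph_range hc hi
  exact ⟨_, φ, hφ 0, hφ 1⟩

/-- The point dividing the segment from `s` to `t` in the ratio `r : 1 - r`. -/
def unitInterval.between (s t r : unitInterval) : unitInterval :=
  ⟨(1 - r) * s + r * t, by
    have := (convex_Icc (0 : ℝ) 1) s.2 t.2 (sub_nonneg.2 r.2.2) r.2.1 (by ring)
    simpa using this⟩

namespace IsLegSystem

variable {Y ι : Type*} [TopologicalSpace Y] {o : Y} {e : ι → unitInterval → Y}

theorem exists_eq (h : IsLegSystem o e) (y : Y) : ∃ i t, e i t = y := by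
  by_cases hy : y = o
  · obtain ⟨i⟩ := h.nonempty
    exact ⟨i, 0, by rw [hy, h.apply_zero]⟩
  · obtain ⟨i, hi⟩ := h.exists_leg {y} isPreconnected_singleton (singleton_nonempty y)
      (by simpa using Ne.symm hy)
    obtain ⟨t, ht⟩ := hi rfl
    exact ⟨i, t, ht⟩

theorem eq_zero (h : IsLegSystem o e) {i : ι} {t : unitInterval} (ht : e i t = o) : t = 0 :=
  h.injective i (ht.trans (h.apply_zero i).symm)

/-- Two legs meeting off `o` have a connected union once `o` is removed, so `exists_leg` applies to
it. -/
theorem exists_common_leg (h : IsLegSystem o e) {i j : ι} {s t : unitInterval}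
    (hst : e i s = e j t) (hs : s ≠ 0) : ∃ k, range (e i) ∪ range (e j) ⊆ range (e k) := by
  have ht : t ≠ 0 := by
    rintro rfl
    rw [h.apply_zero] at hst
    exact hs (h.eq_zero hst)
  have hpre : ∀ i, IsPreconnected (e i '' Ioi 0) := fun i =>
    isPreconnected_Ioi.image _ (h.continuous i).continuousOn
  have hs' := unitInterval.pos_iff_ne_zero.2 hs
  obtain ⟨k, hk⟩ := h.exists_leg (e i '' Ioi 0 ∪ e j '' Ioi 0)
    ((hpre i).union (e i s) ⟨s, hs', rfl⟩ ⟨t, unitInterval.pos_iff_ne_zero.2 ht, hst.symm⟩ (hpre j))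
    ⟨e i s, Or.inl ⟨s, hs', rfl⟩⟩ (by
      rintro (⟨r, hr, hro⟩ | ⟨r, hr, hro⟩) <;>
        exact absurd (h.eq_zero hro) (unitInterval.pos_iff_ne_zero.1 hr))
  refine ⟨k, ?_⟩
  rintro _ (⟨r, rfl⟩ | ⟨r, rfl⟩) <;> by_cases hr : r = 0
  · exact ⟨0, by rw [hr, h.apply_zero, h.apply_zero]⟩
  · exact hk (Or.inl ⟨r, unitInterval.pos_iff_ne_zero.2 hr, rfl⟩)
  · exact ⟨0, by rw [hr, h.apply_zero, h.apply_zero]⟩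
  · exact hk (Or.inr ⟨r, unitInterval.pos_iff_ne_zero.2 hr, rfl⟩)

theorem exists_arc_of_leg [T2Space Y] (h : IsLegSystem o e) {i : ι} {s t : unitInterval}
    (hst : e i s ≠ e i t) :
    ∃ (A : Set Y) (φ : unitInterval ≃ₜ A), (φ 0 : Y) = e i s ∧ (φ 1 : Y) = e i t := by
  have hc : Continuous (unitInterval.between s t) := by
    unfold unitInterval.between
    fun_prop
  have hi : Function.Injective (unitInterval.between s t) := by
    intro r r' hr
    have hne : (t : ℝ) - s ≠ 0 := fun h0 => hst (by rw [Subtype.ext (sub_eq_zero.1 h0)])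
    have hr' := congrArg Subtype.val hr
    simp only [unitInterval.between] at hr'
    have : (t - s : ℝ) * (r - r') = 0 := by linear_combination hr'
    exact Subtype.ext (sub_eq_zero.1 ((mul_eq_zero.1 this).resolve_left hne))
  have h0 : unitInterval.between s t 0 = s := Subtype.ext (by simp [unitInterval.between])
  have h1 : unitInterval.between s t 1 = t := Subtype.ext (by simp [unitInterval.between])
  have := exists_arc ((h.continuous i).comp hc) ((h.injective i).comp hi)
  simpa only [Function.comp_apply, h0, h1] using this

theorem isArcwiseConnected [T2Space Y] (h : IsLegSystem o e) : IsArcwiseConnected Y := by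
  intro x y hxy
  obtain ⟨i, s, rfl⟩ := h.exists_eq x
  obtain ⟨j, t, rfl⟩ := h.exists_eq y
  by_cases hk : ∃ k, range (e i) ∪ range (e j) ⊆ range (e k)
  · obtain ⟨k, hk⟩ := hk
    obtain ⟨s', hs'⟩ := hk (Or.inl ⟨s, rfl⟩)
    obtain ⟨t', ht'⟩ := hk (Or.inr ⟨t, rfl⟩)
    rw [← hs', ← ht'] at hxy ⊢
    exact h.exists_arc_of_leg hxy
  have hmeet : ∀ s t, e i s = e j t → s = 0 ∧ t = 0 := by
    intro s t hst
    have hs : s = 0 := by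
      by_contra hs
      exact hk (h.exists_common_leg hst hs)
    exact ⟨hs, h.eq_zero (by rw [← hst, hs, h.apply_zero])⟩
  by_cases hs : s = 0
  · have : e i s = e j 0 := by rw [hs, h.apply_zero, h.apply_zero]
    rw [this] at hxy ⊢
    exact h.exists_arc_of_leg hxy
  by_cases ht : t = 0
  · have : e j t = e i 0 := by rw [ht, h.apply_zero, h.apply_zero]
    rw [this] at hxy ⊢
    exact h.exists_arc_of_leg hxy
  -- The legs now meet only at `o`: run down leg `i` to `o` at time 1/2, then up leg `j`. Clamping
  -- by `projIcc` keeps both halves defined and continuous for all times.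
  set p : ℝ → unitInterval := fun r => projIcc 0 1 zero_le_one ((1 - 2 * r) * s) with hp
  set q : ℝ → unitInterval := fun r => projIcc 0 1 zero_le_one ((2 * r - 1) * t) with hq
  have hpval : ∀ r : unitInterval, (r : ℝ) ≤ 1 / 2 → (p r : ℝ) = (1 - 2 * r) * s := by
    intro r hr
    have := s.2.1
    have := s.2.2
    have := r.2.1
    rw [hp, coe_projIcc, min_eq_right, max_eq_right] <;> nlinarith
  have hqval : ∀ r : unitInterval, 1 / 2 ≤ (r : ℝ) → (q r : ℝ) = (2 * r - 1) * t := by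
    intro r hr
    have := t.2.1
    have := t.2.2
    have := r.2.2
    rw [hq, coe_projIcc, min_eq_right, max_eq_right] <;> nlinarith
  have hs' : (s : ℝ) ≠ 0 := fun h0 => hs (Subtype.ext h0)
  have ht' : (t : ℝ) ≠ 0 := fun h0 => ht (Subtype.ext h0)
  set γ : unitInterval → Y := fun r => if (r : ℝ) ≤ 1 / 2 then e i (p r) else e j (q r) with hγ
  have hγc : Continuous γ := by
    refine Continuous.if_le ?_ ?_ continuous_subtype_val continuous_const ?_
    · exact (h.continuous i).comp (by fun_prop)
    · exact (h.continuous j).comp (by fun_prop)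
    · intro r hr
      have h1 : p r = 0 := Subtype.ext (by rw [hpval r hr.le, hr]; simp)
      have h2 : q r = 0 := Subtype.ext (by rw [hqval r hr.ge, hr]; simp)
      rw [h1, h2, h.apply_zero, h.apply_zero]
  have hmix : ∀ r r' : unitInterval, (r : ℝ) ≤ 1 / 2 → 1 / 2 < (r' : ℝ) →
      e i (p r) ≠ e j (q r') := by
    intro r r' hr hr' heq
    have h2 := congrArg Subtype.val (hmeet _ _ heq).2
    rw [hqval r' hr'.le] at h2
    rcases mul_eq_zero.1 h2 with h3 | h3
    · linarith
    · exact ht' h3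
  have hγi : Function.Injective γ := by
    intro r r' hr
    simp only [hγ] at hr
    split_ifs at hr with h1 h2 h2
    · have h3 := congrArg Subtype.val (h.injective i hr)
      rw [hpval r h1, hpval r' h2] at h3
      have := mul_right_cancel₀ hs' h3
      exact Subtype.ext (by linarith)
    · exact absurd hr (hmix _ _ h1 (not_le.1 h2))
    · exact absurd hr.symm (hmix _ _ h2 (not_le.1 h1))
    · have h3 := congrArg Subtype.val (h.injective j hr)
      rw [hqval r (not_le.1 h1).le, hqval r' (not_le.1 h2).le] at h3
      have := mul_right_cancel₀ ht' h3
      exact Subtype.ext (by linarith)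
  have h0 : γ 0 = e i s := by
    have h1 : p (0 : unitInterval) = s := Subtype.ext (by rw [hpval] <;> simp)
    simp only [hγ]
    rw [if_pos (by norm_num), h1]
  have h1 : γ 1 = e j t := by
    have h1 : q (1 : unitInterval) = t := Subtype.ext (by rw [hqval] <;> norm_num)
    simp only [hγ]
    rw [if_neg (by norm_num), h1]
  rw [← h0, ← h1]
  exact exists_arc hγc hγi

theorem ordConnected_preimage [T2Space Y] (h : IsLegSystem o e) {A : Set Y} (hA : IsClosed A)
    (hAc : IsPreconnected A) {i : ι} (hi : A ⊆ range (e i) ∨ o ∈ A) :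
    OrdConnected (e i ⁻¹' A) := by
  rcases hi with hi | hi
  · exact (hAc.preimage_of_isClosedMap (h.injective i) (h.continuous i).isClosedMap hi).ordConnected
  · exact IsLowerSet.ordConnected fun t s hst ht => h.downward A hA hAc hi i s t hst ht

theorem isPreconnected_inter_of_subset [T2Space Y] (h : IsLegSystem o e) {A B : Set Y}
    (hA : IsClosed A) (hB : IsClosed B) (hAc : IsPreconnected A) (hBc : IsPreconnected B) {i : ι}
    (hiA : A ⊆ range (e i)) (hiB : B ⊆ range (e i) ∨ o ∈ B) : IsPreconnected (A ∩ B) := by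
  have h1 : OrdConnected (e i ⁻¹' (A ∩ B)) :=
    (h.ordConnected_preimage hA hAc (Or.inl hiA)).inter (h.ordConnected_preimage hB hBc hiB)
  have := h1.isPreconnected.image _ (h.continuous i).continuousOn
  rwa [image_preimage_eq_of_subset (inter_subset_left.trans hiA)] at this

/-- If both sets contain `o`, the intersection is a union of initial arcs. Otherwise one of them
lies in a single leg; if both miss `o`, they share a leg because their union is connected. In a leg,
connected sets are intervals. -/
theorem isPreconnected_inter [T2Space Y] (h : IsLegSystem o e) {A B : Set Y}
    (hA : IsClosed A) (hB : IsClosed B) (hAc : IsPreconnected A) (hBc : IsPreconnected B) :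
    IsPreconnected (A ∩ B) := by
  rcases (A ∩ B).eq_empty_or_nonempty with hne | hne
  · rw [hne]
    exact isPreconnected_empty
  by_cases hoA : o ∈ A <;> by_cases hoB : o ∈ B
  · refine isPreconnected_of_forall o fun y hy => ?_
    obtain ⟨i, t, rfl⟩ := h.exists_eq y
    refine ⟨e i '' Iic t, ?_, ⟨0, unitInterval.nonneg', h.apply_zero i⟩, ⟨t, self_mem_Iic, rfl⟩,
      isPreconnected_Iic.image _ (h.continuous i).continuousOn⟩
    rintro _ ⟨s, hs, rfl⟩
    exact ⟨h.downward A hA hAc hoA i s t hs hy.1, h.downward B hB hBc hoB i s t hs hy.2⟩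
  · obtain ⟨i, hi⟩ := h.exists_leg B hBc hne.right hoB
    rw [inter_comm]
    exact h.isPreconnected_inter_of_subset hB hA hBc hAc hi (Or.inr hoA)
  · obtain ⟨i, hi⟩ := h.exists_leg A hAc hne.left hoA
    exact h.isPreconnected_inter_of_subset hA hB hAc hBc hi (Or.inr hoB)
  · obtain ⟨i, hi⟩ := h.exists_leg (A ∪ B) (hAc.union' hne hBc) hne.left.inl (by simp [hoA, hoB])
    exact h.isPreconnected_inter_of_subset hA hB hAc hBc (subset_union_left.trans hi)
      (Or.inl (subset_union_right.trans hi))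

theorem isHereditarilyUnicoherent [T2Space Y] (h : IsLegSystem o e) :
    IsHereditarilyUnicoherent Y := by
  rintro K ⟨hK, hKc, -⟩ A B ⟨hA, hAc, -⟩ ⟨hB, hBc, -⟩ hAB
  rw [← isCompact_iff_compactSpace] at hA hB
  rw [← isConnected_iff_connectedSpace] at hAc hBc
  refine ⟨?_, ?_⟩
  · have := isPreconnected_closed_iff.1 (isPreconnected_univ (α := K)) A B hA.isClosed hB.isClosed
      hAB.ge (by simpa using hAc.nonempty) (by simpa using hBc.nonempty)
    simpa using this
  · rw [← IsInducing.subtypeVal.isPreconnected_image, image_inter Subtype.val_injective]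
    exact h.isPreconnected_inter (hA.image continuous_subtype_val).isClosed
      (hB.image continuous_subtype_val).isClosed
      (hAc.isPreconnected.image _ continuous_subtype_val.continuousOn)
      (hBc.isPreconnected.image _ continuous_subtype_val.continuousOn)

theorem ramificationPoints_subset [T2Space Y] (h : IsLegSystem o e) :
    ramificationPoints Y ⊆ {o} := by
  refine _root_.ramificationPoints_subset isClosed_singleton fun S hS hSo => ?_
  rw [disjoint_singleton_right] at hSo
  rcases S.eq_empty_or_nonempty with rfl | hne
  · exact ⟨fun _ => 0, continuousOn_empty _, injOn_empty _⟩
  obtain ⟨i, hi⟩ := h.exists_leg S hS hne hSo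
  have hinv : Function.LeftInverse (Function.invFun (e i)) (e i) :=
    Function.leftInverse_invFun (h.injective i)
  refine ⟨fun y => (Function.invFun (e i) y : unitInterval), ?_, ?_⟩
  · refine continuous_subtype_val.comp_continuousOn (ContinuousOn.mono ?_ hi)
    rw [← image_univ,
      ((h.continuous i).isClosedEmbedding (h.injective i)).isInducing.continuousOn_image_iff,
      hinv.comp_eq_id]
    exact continuousOn_id
  · intro y hy z hz hyz
    obtain ⟨s, rfl⟩ := hi hy
    obtain ⟨t, rfl⟩ := hi hz
    have := Subtype.ext hyz
    rw [hinv, hinv] at this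
    rw [this]

theorem isFan [CompactSpace Y] [ConnectedSpace Y] [TopologicalSpace.MetrizableSpace Y]
    (h : IsLegSystem o e) : IsFan Y :=
  ⟨⟨⟨inferInstance, inferInstance, inferInstance⟩, h.isArcwiseConnected,
    h.isHereditarilyUnicoherent⟩, subsingleton_singleton.anti h.ramificationPoints_subset⟩

end IsLegSystem

theorem mem_cantorFan {p : ℝ × ℝ} (hp : p ∈ cantorFan) :
    0 ≤ p.2 ∧ p.2 ≤ 1 ∧ ∃ c ∈ cantorSet, p.1 = c * p.2 := by
  obtain ⟨c, hc, hp⟩ := mem_iUnion₂.1 hp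
  rw [segment_eq_image] at hp
  obtain ⟨t, ht, rfl⟩ := hp
  refine ⟨by simpa using ht.1, by simpa using ht.2, c, hc, ?_⟩
  simp [mul_comm]

/-! ### Separation by lines missing the Cantor set -/

section Separation

variable {X : Set (ℝ × ℝ)} [CompactSpace X] {Y : Type*} [TopologicalSpace Y] [T2Space Y] {q : X → Y}

/-- A line through the origin with parameter `α` cuts `X` into two closed pieces. If `S` met the
images of both, it would meet their intersection, which `h` forbids. -/
theorem label_const (hX : X ⊆ cantorFan) (hq : Continuous q) (hs : Function.Surjective q)
    {S : Set Y} (hS : IsPreconnected S)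
    (h : ∀ α, α ∉ cantorSet → ∀ z w : X, q z = q w → q z ∈ S → z.1.1 ≤ α * z.1.2 →
      α * w.1.2 ≤ w.1.1 → False)
    {c : ℝ} {x y : X} (hx : q x ∈ S) (hy : q y ∈ S)
    (hxc : x.1.1 = c * x.1.2) : y.1.1 = c * y.1.2 := by
  have key : ∀ α, α ∉ cantorSet → ∀ x y : X, q x ∈ S → q y ∈ S → x.1.1 ≤ α * x.1.2 →
      α * y.1.2 ≤ y.1.1 → False := by
    intro α hα x y hx hy hxa hya
    have hZ : IsClosed {z : X | z.1.1 ≤ α * z.1.2} := isClosed_le (by fun_prop) (by fun_prop)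
    have hW : IsClosed {z : X | α * z.1.2 ≤ z.1.1} := isClosed_le (by fun_prop) (by fun_prop)
    obtain ⟨_, hyS, ⟨z, hz, rfl⟩, w, hw, hzw⟩ := isPreconnected_closed_iff.1 hS _ _
      (hq.isClosedMap _ hZ) (hq.isClosedMap _ hW)
      (by
        intro y _
        obtain ⟨z, rfl⟩ := hs y
        rcases le_total z.1.1 (α * z.1.2) with h | h
        · exact Or.inl ⟨z, h, rfl⟩
        · exact Or.inr ⟨z, h, rfl⟩)
      ⟨_, hx, x, hxa, rfl⟩ ⟨_, hy, y, hya, rfl⟩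
    exact h α hα z w hzw.symm hyS hz hw
  obtain ⟨hx0, -, -⟩ := mem_cantorFan (hX x.2)
  obtain ⟨hy0, -, c', -, hyc⟩ := mem_cantorFan (hX y.2)
  rcases lt_trichotomy c c' with hlt | rfl | hlt
  · obtain ⟨α, hα, hαC⟩ := exists_notMem_cantorSet hlt
    exact (key α hαC x y hx hy (hxc ▸ mul_le_mul_of_nonneg_right hα.1.le hx0)
      (hyc ▸ mul_le_mul_of_nonneg_right hα.2.le hy0)).elim
  · exact hyc
  · obtain ⟨α, hα, hαC⟩ := exists_notMem_cantorSet hlt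
    exact (key α hαC y x hy hx (hyc ▸ mul_le_mul_of_nonneg_right hα.1.le hy0)
      (hxc ▸ mul_le_mul_of_nonneg_right hα.2.le hx0)).elim

/-- A thin box around the ray between heights `t₁` and `t₂` has boundary disjoint from the preimage
of `B`, and `hsat` makes it compatible with the fibres of `q`. Its trace on `B` is therefore clopen,
yet omits `q z₀`. -/
theorem not_mem_between (hX : X ⊆ cantorFan) (hq : Continuous q) (hs : Function.Surjective q)
    {B : Set Y} (hB : IsClosed B) (hBc : IsPreconnected B) {z₀ : X} (hz₀ : z₀.1.2 = 0)
    (hz₀B : q z₀ ∈ B) {c ε t₁ t₂ : ℝ} (hε : 0 < ε) (ht₁ : 0 < t₁)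
    (h : ∀ z : X, z.1.1 = c * z.1.2 → z.1.2 = t₁ ∨ z.1.2 = t₂ → q z ∉ B)
    (hsat : ∀ z w : X, q z = q w → |z.1.1 - c * z.1.2| < ε * z.1.2 → t₁ < z.1.2 → z.1.2 < t₂ →
      w.1.1 * z.1.2 = z.1.1 * w.1.2 ∧ t₁ < w.1.2 ∧ w.1.2 < t₂)
    {x : X} (hxc : x.1.1 = c * x.1.2) (hx₁ : t₁ < x.1.2) (hx₂ : x.1.2 < t₂) : q x ∉ B := by
  intro hxB
  have hA : IsClosed (q ⁻¹' B) := hB.preimage hq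
  -- By compactness, the preimage of `B` stays a distance `m` from the ray at both bounding heights.
  obtain ⟨m, hm, hmK⟩ : ∃ m > 0, ∀ z : X, q z ∈ B → z.1.2 = t₁ ∨ z.1.2 = t₂ →
      m ≤ |z.1.1 - c * z.1.2| := by
    have hK : IsCompact (q ⁻¹' B ∩ ({z : X | z.1.2 = t₁} ∪ {z : X | z.1.2 = t₂})) :=
      (hA.inter ((isClosed_eq (by fun_prop) (by fun_prop)).union
        (isClosed_eq (by fun_prop) (by fun_prop)))).isCompact
    rcases (q ⁻¹' B ∩ ({z : X | z.1.2 = t₁} ∪ {z : X | z.1.2 = t₂})).eq_empty_or_nonempty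
      with hne | hne
    · refine ⟨1, one_pos, fun z hz hz' => ?_⟩
      exact absurd (show z ∈ q ⁻¹' B ∩ ({z : X | z.1.2 = t₁} ∪ {z : X | z.1.2 = t₂}) from ⟨hz, hz'⟩)
        (by rw [hne]; simp)
    · obtain ⟨z, hz, hmin⟩ := hK.exists_isMinOn hne
        (f := fun z : X => |z.1.1 - c * z.1.2|) (by fun_prop)
      exact ⟨_, abs_pos.2 fun h0 => h z (sub_eq_zero.1 h0) hz.2 hz.1,
        fun w hw hw' => hmin ⟨hw, hw'⟩⟩
  have hδ : 0 < min ε m := lt_min hε hm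
  obtain ⟨α, hα, hαC⟩ := exists_notMem_cantorSet (sub_lt_self c hδ)
  obtain ⟨β, hβ, hβC⟩ := exists_notMem_cantorSet (lt_add_of_pos_right c hδ)
  have hbox : ∀ z : X, t₁ ≤ z.1.2 → α * z.1.2 ≤ z.1.1 → z.1.1 ≤ β * z.1.2 →
      |z.1.1 - c * z.1.2| < min ε m * z.1.2 := by
    intro z h1 h2 h3
    have h0 := ht₁.trans_le h1
    have h4 := mul_lt_mul_of_pos_right hα.1 h0
    have h5 := mul_lt_mul_of_pos_right hβ.2 h0
    rw [abs_lt]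
    constructor <;> linarith
  have hZ : IsClosed {z : X | t₁ ≤ z.1.2 ∧ z.1.2 ≤ t₂ ∧ α * z.1.2 ≤ z.1.1 ∧ z.1.1 ≤ β * z.1.2} := by
    simp only [ofPred_and]
    refine .inter ?_ (.inter ?_ (.inter ?_ ?_)) <;>
      exact isClosed_le (by fun_prop) (by fun_prop)
  have hU : IsOpen {z : X | t₁ < z.1.2 ∧ z.1.2 < t₂ ∧ α * z.1.2 < z.1.1 ∧ z.1.1 < β * z.1.2} := by
    simp only [ofPred_and]
    refine .inter ?_ (.inter ?_ (.inter ?_ ?_)) <;>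
      exact isOpen_lt (by fun_prop) (by fun_prop)
  have hZU : ∀ z : X, q z ∈ B → t₁ ≤ z.1.2 → z.1.2 ≤ t₂ → α * z.1.2 ≤ z.1.1 →
      z.1.1 ≤ β * z.1.2 →
      t₁ < z.1.2 ∧ z.1.2 < t₂ ∧ α * z.1.2 < z.1.1 ∧ z.1.1 < β * z.1.2 := by
    intro z hz h1 h2 h3 h4
    obtain ⟨-, hz1, c', hc', hzc⟩ := mem_cantorFan (hX z.2)
    have h0 := ht₁.trans_le h1
    have hlt : ¬ (z.1.2 = t₁ ∨ z.1.2 = t₂) := by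
      intro h5
      have h6 := hmK z hz h5
      have h7 := hbox z h1 h3 h4
      have h8 : min ε m * z.1.2 ≤ m := by
        calc min ε m * z.1.2 ≤ min ε m * 1 := mul_le_mul_of_nonneg_left hz1 hδ.le
          _ ≤ m := by rw [mul_one]; exact min_le_right _ _
      linarith
    push Not at hlt
    refine ⟨lt_of_le_of_ne h1 hlt.1.symm, lt_of_le_of_ne h2 hlt.2, lt_of_le_of_ne h3 ?_,
      lt_of_le_of_ne h4 ?_⟩
    · intro h5
      exact hαC (mul_right_cancel₀ h0.ne' (h5.trans hzc) ▸ hc')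
    · intro h5
      exact hβC (mul_right_cancel₀ h0.ne' (h5.symm.trans hzc) ▸ hc')
  obtain ⟨_, -, ⟨z, ⟨hzB, hz1, hz2, hz3, hz4⟩, rfl⟩, w, ⟨hwB, hwU⟩, hzw⟩ :=
    isPreconnected_closed_iff.1 hBc _ _
      (hq.isClosedMap _ (hA.inter hZ)) (hq.isClosedMap _ (hA.inter hU.isClosed_compl))
      (by
        intro y hy
        obtain ⟨z, rfl⟩ := hs y
        by_cases hz : z ∈
            {z : X | t₁ < z.1.2 ∧ z.1.2 < t₂ ∧ α * z.1.2 < z.1.1 ∧ z.1.1 < β * z.1.2}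
        · exact Or.inl ⟨z, ⟨hy, hz.1.le, hz.2.1.le, hz.2.2.1.le, hz.2.2.2.le⟩, rfl⟩
        · exact Or.inr ⟨z, ⟨hy, hz⟩, rfl⟩)
      ⟨_, hxB, x, ⟨hxB, hx₁.le, hx₂.le,
        hxc ▸ mul_le_mul_of_nonneg_right hα.2.le (ht₁.trans hx₁).le,
        hxc ▸ mul_le_mul_of_nonneg_right hβ.1.le (ht₁.trans hx₁).le⟩, rfl⟩
      ⟨_, hz₀B, z₀, ⟨hz₀B, fun hz => by linarith [hz.1]⟩, rfl⟩
  obtain ⟨h1, h2, h3, h4⟩ := hZU z hzB hz1 hz2 hz3 hz4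
  have h0 := ht₁.trans_le hz1
  obtain ⟨h5, h6, h7⟩ := hsat z w hzw.symm
    ((hbox z hz1 hz3 hz4).trans_le (mul_le_mul_of_nonneg_right (min_le_left _ _) h0.le)) h1 h2
  have hw0 := ht₁.trans h6
  refine hwU ⟨h6, h7, ?_, ?_⟩
  · refine lt_of_mul_lt_mul_right ?_ h0.le
    have := mul_lt_mul_of_pos_right h3 hw0
    linarith
  · refine lt_of_mul_lt_mul_right ?_ h0.le
    have := mul_lt_mul_of_pos_right h4 hw0
    linarith

end Separation

/-! ### Geometry of subfans of the Cantor fan -/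

section SubfanOfCantorFan

variable {X : Set (ℝ × ℝ)}

theorem eq_zero_of_snd_eq_zero (hX : X ⊆ cantorFan) {x : X} (hx : x.1.2 = 0) : x.1 = 0 := by
  obtain ⟨-, -, c, -, hxc⟩ := mem_cantorFan (hX x.2)
  exact Prod.ext (by simp [hxc, hx]) hx

theorem snd_pos (hX : X ⊆ cantorFan) {x : X} (hx : x.1 ≠ 0) : 0 < x.1.2 :=
  lt_of_le_of_ne (mem_cantorFan (hX x.2)).1 fun h => hx (eq_zero_of_snd_eq_zero hX h.symm)

theorem eq_zero_of_label_notMem (hX : X ⊆ cantorFan) {x : X} {α : ℝ} (hα : α ∉ cantorSet)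
    (h : x.1.1 = α * x.1.2) : x.1 = 0 := by
  by_contra hx
  obtain ⟨-, -, c, hc, hxc⟩ := mem_cantorFan (hX x.2)
  exact hα (mul_right_cancel₀ (snd_pos hX hx).ne' (h.symm.trans hxc) ▸ hc)

theorem ramificationPoints_subset_zero [CompactSpace X] (hX : X ⊆ cantorFan) :
    ramificationPoints X ⊆ {x : X | x.1 = 0} := by
  refine ramificationPoints_subset (isClosed_eq (by fun_prop) (by fun_prop)) fun S hS hS0 => ?_
  refine ⟨fun x => x.1.2, by fun_prop, fun x hx y hy hxy => ?_⟩
  obtain ⟨-, -, c, -, hxc⟩ := mem_cantorFan (hX x.2)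
  have := label_const hX continuous_id Function.surjective_id hS
    (by
      rintro α hα z w rfl hz h1 h2
      exact Set.disjoint_left.1 hS0 hz (eq_zero_of_label_notMem hX hα (le_antisymm h1 h2)))
    hx hy hxc
  exact Subtype.ext (Prod.ext (by rw [hxc, this, show x.1.2 = y.1.2 from hxy]) hxy)

theorem smul_mem_of_mem [CompactSpace X] [PreconnectedSpace X] (hX : X ⊆ cantorFan)
    (h0 : (0 : ℝ × ℝ) ∈ X) {x : ℝ × ℝ}
    (hx : x ∈ X) {r : ℝ} (hr : r ∈ Icc (0 : ℝ) 1) : r • x ∈ X := by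
  rcases hr.1.eq_or_lt with rfl | hr0
  · simpa using h0
  rcases hr.2.eq_or_lt with rfl | hr1
  · simpa using hx
  by_cases hx0 : x = 0
  · simpa [hx0] using h0
  have hpos : 0 < x.2 := snd_pos hX (x := ⟨x, hx⟩) hx0
  obtain ⟨-, hle, c, hc, hxc⟩ := mem_cantorFan (hX hx)
  by_contra hrx
  -- Take `q` the identity and `B` everything: a missing point `r • x` would disconnect `x` from the
  -- origin. Height 2 lies above the whole fan, so the upper face is vacuous.
  refine not_mem_between (c := c) (ε := 1) (t₁ := r * x.2) (t₂ := 2) (z₀ := ⟨0, h0⟩) hX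
    continuous_id Function.surjective_id
    isClosed_univ isPreconnected_univ rfl (mem_univ _) one_pos (mul_pos hr0 hpos) ?_ ?_
    (x := ⟨x, hx⟩) hxc (by simp only; nlinarith) (by simp only; linarith) (mem_univ _)
  · rintro z hz (h1 | h1)
    · refine absurd z.2 ?_
      convert hrx
      exact Prod.ext (by simp [hz, h1, hxc]; ring) (by simp [h1])
    · have := (mem_cantorFan (hX z.2)).2.1
      linarith
  · rintro z w rfl - h1 h2
    exact ⟨rfl, h1, h2⟩

/-- The origin is the top, hence interior to the horizontal bar of a triod, so it is no end-point.
-/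
theorem snd_pos_of_mem_endPoints [CompactSpace X] (hX : X ⊆ cantorFan)
    (htop : (ramificationPoints X).Nonempty)
    {a : X} (ha : a ∈ endPoints X) : 0 < a.1.2 := by
  refine snd_pos hX fun ha0 => ?_
  obtain ⟨x, hx⟩ := htop
  have hx0 : x.1 = 0 := ramificationPoints_subset_zero hX hx
  obtain rfl : x = a := Subtype.ext (hx0.trans ha0.symm)
  obtain ⟨T, φ, hφ⟩ := hx
  have hmem : ∀ t : unitInterval, ((2 * t - 1, 0) : ℝ × ℝ) ∈ simpleTriod := fun t =>
    Or.inl ⟨⟨by linarith [t.2.1], by linarith [t.2.2]⟩, rfl⟩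
  set γ : unitInterval → X := fun t => φ ⟨(2 * t - 1, 0), hmem t⟩ with hγ
  have hc : Continuous γ := by fun_prop
  have hi : Function.Injective γ := by
    intro s t hst
    have := congrArg Subtype.val (φ.injective (Subtype.ext hst))
    simp only [Prod.mk.injEq] at this
    exact Subtype.ext (by linarith [this.1])
  have h12 : (1 / 2 : ℝ) ∈ Icc (0 : ℝ) 1 := by constructor <;> norm_num
  have := notMem_endPoints hc hi (t := ⟨1 / 2, h12⟩)
    (by rw [← Subtype.coe_lt_coe]; norm_num) (by rw [← Subtype.coe_lt_coe]; norm_num)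
  have hγx : γ ⟨1 / 2, h12⟩ = x := by
    rw [← hφ]
    simp [hγ]
  exact this (hγx ▸ ha)

theorem snd_le_of_mem_endPoints
    (hstar : ∀ x ∈ X, ∀ r ∈ Icc (0 : ℝ) 1, r • x ∈ X)
    {a : X} (ha : a ∈ endPoints X) (ha0 : 0 < a.1.2) {c : ℝ} (hac : a.1.1 = c * a.1.2) {x : X}
    (hxc : x.1.1 = c * x.1.2) : x.1.2 ≤ a.1.2 := by
  by_contra! hlt
  have hx0 := ha0.trans hlt
  set γ : unitInterval → X := fun t => ⟨(t : ℝ) • x.1, hstar x x.2 t t.2⟩ with hγ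
  have hc : Continuous γ := by fun_prop
  have hi : Function.Injective γ := by
    intro s t hst
    have := congrArg (fun x : X => x.1.2) hst
    simp only [hγ, Prod.smul_snd, smul_eq_mul] at this
    exact Subtype.ext (mul_right_cancel₀ hx0.ne' this)
  have hr1 : a.1.2 / x.1.2 < 1 := (div_lt_one hx0).2 hlt
  have hr0 : 0 < a.1.2 / x.1.2 := div_pos ha0 hx0
  refine notMem_endPoints hc hi (t := ⟨a.1.2 / x.1.2, hr0.le, hr1.le⟩)
    (by rw [← Subtype.coe_lt_coe]; exact hr0) (by rw [← Subtype.coe_lt_coe]; exact hr1) ?_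
  convert ha
  refine Subtype.ext (Prod.ext ?_ ?_)
  · simp only [hγ, Prod.smul_fst, smul_eq_mul, hac, hxc]
    field_simp
  · simp only [hγ, Prod.smul_snd, smul_eq_mul]
    field_simp

end SubfanOfCantorFan

/-! ### The folded quotient -/

section Fold

variable {X : Set (ℝ × ℝ)} {a : X} {c₀ : ℝ}

theorem foldQuotient_mk_eq_iff (hX : X ⊆ cantorFan) (hac : a.1.1 = c₀ * a.1.2) (ha0 : 0 < a.1.2)
    {z w : X} : (Quotient.mk _ z : FoldQuotient X a) = Quotient.mk _ w ↔
      z = w ∨ z.1.1 = c₀ * z.1.2 ∧ w.1.1 = c₀ * w.1.2 ∧ z.1.2 + w.1.2 = a.1.2 := by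
  rw [Quotient.eq]
  refine or_congr Iff.rfl ⟨?_, ?_⟩
  · rintro ⟨t, -, hz, hw⟩
    rw [hz, hw]
    simp only [Prod.smul_fst, Prod.smul_snd, smul_eq_mul, hac]
    refine ⟨by ring, by ring, by ring⟩
  · rintro ⟨hz, hw, hzw⟩
    have hz0 := (mem_cantorFan (hX z.2)).1
    have hw0 := (mem_cantorFan (hX w.2)).1
    refine ⟨z.1.2 / a.1.2, ⟨by positivity, (div_le_one ha0).2 (by linarith)⟩, ?_, ?_⟩
    · refine Prod.ext ?_ ?_
      · simp only [Prod.smul_fst, smul_eq_mul, hac, hz]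
        field_simp
      · simp only [Prod.smul_snd, smul_eq_mul]
        field_simp
    · have hw' : w.1.2 = a.1.2 - z.1.2 := by linarith
      refine Prod.ext ?_ ?_
      · simp only [Prod.smul_fst, smul_eq_mul, hac, hw, hw']
        field_simp
      · simp only [Prod.smul_snd, smul_eq_mul, hw']
        field_simp

theorem metrizableSpace_foldQuotient [CompactSpace X] (hX : X ⊆ cantorFan)
    (hac : a.1.1 = c₀ * a.1.2) (ha0 : 0 < a.1.2) :
    TopologicalSpace.MetrizableSpace (FoldQuotient X a) := by
  -- Off the folded ray the first two coordinates recover the point; on it they vanish, and the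
  -- third determines the height exactly up to the fold.
  set f : X → ℝ × ℝ × ℝ := fun z => (z.1.1 - c₀ * z.1.2, (z.1.1 - c₀ * z.1.2) * z.1.2,
    z.1.2 * (a.1.2 - z.1.2)) with hf
  have hfc : Continuous f := by fun_prop
  have hfeq : ∀ z w : X,
      f z = f w ↔ (Quotient.mk _ z : FoldQuotient X a) = Quotient.mk _ w := by
    intro z w
    rw [foldQuotient_mk_eq_iff hX hac ha0]
    simp only [hf, Prod.mk.injEq]
    constructor
    · rintro ⟨h1, h2, h3⟩
      by_cases h0 : z.1.1 - c₀ * z.1.2 = 0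
      · have h4 : (z.1.2 - w.1.2) * (a.1.2 - z.1.2 - w.1.2) = 0 := by linear_combination h3
        rcases mul_eq_zero.1 h4 with h5 | h5
        · have h6 : z.1.2 = w.1.2 := by linarith
          exact Or.inl (Subtype.ext (Prod.ext (by rw [h6] at h1; linarith) h6))
        · exact Or.inr ⟨by linarith, by linarith, by linarith⟩
      · have h6 : z.1.2 = w.1.2 := by
          rw [← h1] at h2
          exact mul_left_cancel₀ h0 h2
        exact Or.inl (Subtype.ext (Prod.ext (by rw [h6] at h1; linarith) h6))
    · rintro (rfl | ⟨h1, h2, h3⟩)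
      · exact ⟨rfl, rfl, rfl⟩
      · have h4 : w.1.2 = a.1.2 - z.1.2 := by linarith
        simp only [h1, h2, h4]
        refine ⟨by ring, by ring, by ring⟩
  have hgc : Continuous (Quotient.lift f fun z w h => (hfeq z w).2 (Quotient.sound h)) :=
    hfc.quotient_lift _
  refine (hgc.isClosedEmbedding ?_).isEmbedding.metrizableSpace
  rintro ⟨z⟩ ⟨w⟩ h
  exact (hfeq z w).1 h

/-- Legs are indexed by their tips, the cap at `a.1.2 / 2` keeping those on the folded ray
injective. -/
theorem isLegSystem_foldQuotient [CompactSpace X] [T2Space (FoldQuotient X a)]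
    (hX : X ⊆ cantorFan) (hc₀ : c₀ ∈ cantorSet)
    (hac : a.1.1 = c₀ * a.1.2) (ha0 : 0 < a.1.2)
    (hstar : ∀ x ∈ X, ∀ r ∈ Icc (0 : ℝ) 1, r • x ∈ X)
    (hmax : ∀ x : X, x.1.1 = c₀ * x.1.2 → x.1.2 ≤ a.1.2) :
    IsLegSystem (Quotient.mk _ ⟨0, by simpa using hstar a a.2 0 (by simp)⟩ : FoldQuotient X a)
      (fun (p : {p : X // 0 < p.1.2 ∧ (p.1.1 = c₀ * p.1.2 → p.1.2 ≤ a.1.2 / 2)})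
        (t : unitInterval) => Quotient.mk _ ⟨(t : ℝ) • p.1.1, hstar _ p.1.2 t t.2⟩) := by
  have hq : Continuous (Quotient.mk (foldSetoid X a)) := continuous_quotient_mk'
  have hs : Function.Surjective (Quotient.mk (foldSetoid X a)) := Quotient.mk_surjective
  have hzero : (0 : ℝ × ℝ) ∈ X := by simpa using hstar a a.2 0 (by simp)
  refine ⟨fun p => ?_, fun p => ?_, fun p => ?_, ?_, ?_, ?_⟩
  · exact hq.comp (by fun_prop)
  · intro s t hst
    rcases (foldQuotient_mk_eq_iff hX hac ha0).1 hst with h | ⟨h1, h2, h3⟩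
    · have := congrArg (fun x : X => x.1.2) h
      simp only [Prod.smul_snd, smul_eq_mul] at this
      exact Subtype.ext (mul_right_cancel₀ p.2.1.ne' this)
    · simp only [Prod.smul_fst, Prod.smul_snd, smul_eq_mul] at h1 h2 h3
      by_cases hp : p.1.1.1 = c₀ * p.1.1.2
      -- Two heights of at most half that of `a` can sum to it only if both are equal to the half.
      · have h4 := p.2.2 hp
        have hs1 := s.2.2
        have ht1 := t.2.2
        have h5 := p.2.1
        exact Subtype.ext (by nlinarith)
      · have h4 : (s : ℝ) * (p.1.1.1 - c₀ * p.1.1.2) = 0 := by linear_combination h1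
        have h5 : (t : ℝ) * (p.1.1.1 - c₀ * p.1.1.2) = 0 := by linear_combination h2
        have h6 := sub_ne_zero.2 hp
        exact Subtype.ext (((mul_eq_zero.1 h4).resolve_right h6).trans
          ((mul_eq_zero.1 h5).resolve_right h6).symm)
  · congr 1
    exact Subtype.ext (by simp)
  · refine ⟨⟨⟨(1 / 2 : ℝ) • a.1, hstar a a.2 _ (by constructor <;> norm_num)⟩, ?_, ?_⟩⟩
    · simp only [Prod.smul_snd, smul_eq_mul]
      linarith
    · intro _
      simp only [Prod.smul_snd, smul_eq_mul]
      linarith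
  · rintro S hS ⟨y, hy⟩ hoS
    have hpos : ∀ z : X, Quotient.mk (foldSetoid X a) z ∈ S → 0 < z.1.2 := fun z hz =>
      snd_pos hX fun h0 => hoS (by rwa [show z = ⟨0, hzero⟩ from Subtype.ext h0] at hz)
    obtain ⟨x, rfl⟩ := hs y
    obtain ⟨-, -, c, hc, hxc⟩ := mem_cantorFan (hX x.2)
    have hlab : ∀ z : X, Quotient.mk (foldSetoid X a) z ∈ S → z.1.1 = c * z.1.2 := by
      intro z hz
      refine label_const hX hq hs hS ?_ hy hz hxc
      intro α hα z w hzw hzS h1 h2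
      rcases (foldQuotient_mk_eq_iff hX hac ha0).1 hzw with rfl | ⟨h3, h4, h5⟩
      · exact (hpos z hzS).ne' (by
          rw [eq_zero_of_label_notMem hX hα (le_antisymm h1 h2)]; rfl)
      · have h6 := hpos z hzS
        have h7 := hpos w (hzw ▸ hzS)
        have h8 := le_of_mul_le_mul_right (h3 ▸ h1) h6
        have h9 := le_of_mul_le_mul_right (h4 ▸ h2) h7
        exact hα (le_antisymm h8 h9 ▸ hc₀)
    by_cases hcc : c = c₀
    · subst hcc
      refine ⟨⟨⟨(1 / 2 : ℝ) • a.1, hstar a a.2 _ (by constructor <;> norm_num)⟩, ?_, ?_⟩, ?_⟩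
      · simp only [Prod.smul_snd, smul_eq_mul]
        linarith
      · intro _
        simp only [Prod.smul_snd, smul_eq_mul]
        linarith
      · intro y hy
        obtain ⟨z, rfl⟩ := hs y
        have hzc := hlab z hy
        have hz0 := hpos z hy
        have hz1 := hmax z hzc
        rcases le_total z.1.2 (a.1.2 / 2) with hz | hz
        · refine ⟨⟨2 * z.1.2 / a.1.2, by positivity, (div_le_one ha0).2 (by linarith)⟩, ?_⟩
          refine (foldQuotient_mk_eq_iff hX hac ha0).2 (Or.inl (Subtype.ext (Prod.ext ?_ ?_)))
          · simp only [Prod.smul_fst, smul_eq_mul, hac, hzc]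
            field_simp
          · simp only [Prod.smul_snd, smul_eq_mul]
            field_simp
        -- Above the midpoint, use the mirror image.
        · refine ⟨⟨2 * (a.1.2 - z.1.2) / a.1.2, div_nonneg (by linarith) ha0.le,
            (div_le_one ha0).2 (by linarith)⟩, ?_⟩
          refine (foldQuotient_mk_eq_iff hX hac ha0).2 (Or.inr ⟨?_, hzc, ?_⟩)
          · simp only [Prod.smul_fst, Prod.smul_snd, smul_eq_mul, hac]
            ring
          · simp only [Prod.smul_snd, smul_eq_mul]
            field_simp
            ring
    · have hK : IsCompact {z : X | z.1.1 = c * z.1.2} :=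
        (isClosed_eq (by fun_prop) (by fun_prop)).isCompact
      obtain ⟨p, hp, hpmax⟩ := hK.exists_isMaxOn ⟨x, hxc⟩ (f := fun z : X => z.1.2) (by fun_prop)
      have hp0 : 0 < p.1.2 := (hpos x hy).trans_le (hpmax hxc)
      refine ⟨⟨p, hp0, fun h =>
        absurd (mul_right_cancel₀ hp0.ne' (Eq.trans (Eq.symm hp) h)) hcc⟩, ?_⟩
      intro y hy
      obtain ⟨z, rfl⟩ := hs y
      have hzc := hlab z hy
      have hz0 := hpos z hy
      have hzp : z.1.2 ≤ p.1.2 := hpmax hzc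
      refine ⟨⟨z.1.2 / p.1.2, by positivity, (div_le_one hp0).2 hzp⟩, ?_⟩
      refine congrArg (Quotient.mk (foldSetoid X a)) (Subtype.ext (Prod.ext ?_ ?_))
      · simp only [Prod.smul_fst, smul_eq_mul, hzc, show p.1.1 = c * p.1.2 from hp]
        field_simp
      · simp only [Prod.smul_snd, smul_eq_mul]
        field_simp
  · intro B hB hBc hoB p s t hst htB
    by_contra hsB
    rcases hst.eq_or_lt with rfl | hlt
    · exact hsB htB
    rcases (unitInterval.nonneg' (t := s)).eq_or_lt with rfl | hs0
    · refine hsB ?_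
      convert hoB
      simp
    have hp0 := p.2.1
    have hs0' : (0 : ℝ) < s := hs0
    have hlt' : (s : ℝ) < t := hlt
    have ht1 := t.2.2
    obtain ⟨-, hp1, c, hc, hpc⟩ := mem_cantorFan (hX p.1.2)
    have hts : (s : ℝ) * p.1.1.2 < t * p.1.1.2 := mul_lt_mul_of_pos_right hlt' hp0
    have htp : (t : ℝ) * p.1.1.2 ≤ p.1.1.2 := mul_le_of_le_one_left hp0.le ht1
    have hxc : ((t : ℝ) • p.1.1).1 = c * ((t : ℝ) • p.1.1).2 := by
      simp only [Prod.smul_fst, Prod.smul_snd, smul_eq_mul, hpc]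
      ring
    have hsP : ∀ z : X, z.1.1 = c * z.1.2 → z.1.2 = s * p.1.1.2 →
        Quotient.mk (foldSetoid X a) z ∉ B := by
      intro z hz h1 hzB
      refine hsB ?_
      convert hzB
      exact Prod.ext (by simp [hz, h1, hpc]; ring) (by simp [h1])
    by_cases hcc : c = c₀
    · subst hcc
      have hpa := p.2.2 hpc
      -- The height band is symmetric under the fold, so it is saturated and its two bounding points
      -- on the ray are identified.
      refine not_mem_between (c := c) (ε := 1) (t₁ := s * p.1.1.2) (t₂ := a.1.2 - s * p.1.1.2)
        (z₀ := ⟨0, hzero⟩) hX hq hs hB hBc rfl hoB one_pos (mul_pos hs0' hp0) ?_ ?_ hxc ?_ ?_ htB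
      · rintro z hz (h1 | h1)
        · exact hsP z hz h1
        · intro hzB
          refine hsP ⟨(s : ℝ) • p.1.1, hstar _ p.1.2 s s.2⟩ ?_ rfl ?_
          · simp only [Prod.smul_fst, Prod.smul_snd, smul_eq_mul, hpc]
            ring
          · rwa [(foldQuotient_mk_eq_iff hX hac ha0 (w := z)).2 (Or.inr ⟨?_, hz, ?_⟩)]
            · simp only [Prod.smul_fst, Prod.smul_snd, smul_eq_mul, hpc]
              ring
            · simp only [Prod.smul_snd, smul_eq_mul, h1]
              ring
      · intro z w hzw _ h1 h2
        rcases (foldQuotient_mk_eq_iff hX hac ha0).1 hzw with rfl | ⟨h3, h4, h5⟩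
        · exact ⟨rfl, h1, h2⟩
        · refine ⟨by rw [h3, h4]; ring, by linarith, by linarith⟩
      · exact hts
      · simp only [Prod.smul_snd, smul_eq_mul]
        linarith
    -- This `ε` keeps the box off the folded ray, where `q` is not injective.
    · refine not_mem_between (c := c) (ε := |c₀ - c|) (t₁ := s * p.1.1.2) (t₂ := 2)
        (z₀ := ⟨0, hzero⟩) hX hq hs hB hBc rfl hoB (abs_pos.2 (sub_ne_zero.2 (Ne.symm hcc)))
        (mul_pos hs0' hp0) ?_ ?_ hxc ?_ ?_ htB
      · rintro z hz (h1 | h1)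
        · exact hsP z hz h1
        · have := (mem_cantorFan (hX z.2)).2.1
          linarith
      · intro z w hzw hz h1 h2
        rcases (foldQuotient_mk_eq_iff hX hac ha0).1 hzw with rfl | ⟨h3, h4, h5⟩
        · exact ⟨rfl, h1, h2⟩
        · rw [h3, ← sub_mul, abs_mul, abs_of_nonneg (mem_cantorFan (hX z.2)).1] at hz
          exact absurd hz (lt_irrefl _)
      · exact hts
      · simp only [Prod.smul_snd, smul_eq_mul]
        linarith

end Fold

theorem mainTheorem3 (X : Set (ℝ × ℝ)) (hX : X ⊆ cantorFan) (hfan : IsFan X)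
    (htop : (ramificationPoints X).Nonempty) (a : X) (ha : a ∈ endPoints X) :
    IsFan (FoldQuotient X a) := by
  obtain ⟨⟨⟨hcomp, hconn, -⟩, -, -⟩, -⟩ := hfan
  have hzero : (0 : ℝ × ℝ) ∈ X := by
    obtain ⟨x, hx⟩ := htop
    rw [← show x.1 = 0 from ramificationPoints_subset_zero hX hx]
    exact x.2
  have ha0 := snd_pos_of_mem_endPoints hX htop ha
  obtain ⟨-, -, c₀, hc₀, hac⟩ := mem_cantorFan (hX a.2)
  have hstar : ∀ x ∈ X, ∀ r ∈ Icc (0 : ℝ) 1, r • x ∈ X :=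
    fun x hx r hr => smul_mem_of_mem hX hzero hx hr
  have := metrizableSpace_foldQuotient hX hac ha0
  exact (isLegSystem_foldQuotient hX hc₀ hac ha0 hstar fun x hx =>
    snd_le_of_mem_endPoints hstar ha ha0 hac hx).isFan
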